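/- For a real symmetric $n\times n$ matrix $A$ with $n\ge 2$, let $\delta_1(A)\ge\delta_2(A)\ge\dots\ge\delta_n(A)$ be its eigenvalues, counted with multiplicity, and put $\lambda_2(A)=\max(|\delta_2(A)|,|\delta_n(A)|)$. For every constant $p>0$ there exist constants $c_p,K_p>0$, depending only on $p$, such that the following holds. Let $n\ge 2$, let $a_{ij}$ ($1\le i\le j\le n$) be independent real random variables (not necessarily identically distributed) with absolute value at most $1$, and suppose that $\mathbb{E}[a_{ij}]=p$ for all $1\le i<j\le n$. Let $A$ be the random symmetric $n\times n$ matrix with entries $a_{ij}$ for $i\le j$ and $a_{ji}=a_{ij}$ for $i<j$. Then, for all $t>K_p$, $$\Pr\bigl[\,|\lambda_2(A)-\mathbb{E}\lambda_2(A)|\ge t\,\bigr]\le e^{-c_pt^2} \qquad\text{and}\qquad \Pr\bigl[\,|\delta_2(A)-\mathbb{E}\delta_2(A)|\ge t\,\bigr]\le e^{-c_pt^2}.$$ -/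

import Mathlib

/-!
Let `F` be a function of independent coordinates in a space of diameter `δ` such that
`F x - F y ≤ ∑ i, β i * dist (x i) (y i)` with weights `β` that depend on `x` only and satisfy
`∑ i, β i ^ 2 ≤ V`. Then `t * F - δ ^ 2 * V * t ^ 2` is at most the weak infimal convolution
`Q (t * F)`, where `Q f x` is the supremum over `β` of
`(⨅ y, f y + ∑ i, β i * dist (x i) (y i)) - δ ^ 2 * ∑ i, β i ^ 2`. The transport inequality
`(∫ exp (Q f)) * ∫ exp (-f) ≤ 1`, proved one coordinate at a time, bounds the product of the
moment generating functions of `F` at `t` and `-t`, and by Jensen's inequality `F` is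
sub-Gaussian around its mean.

The `s`-th largest eigenvalue satisfies the one-sided condition with `V = 2 * s ^ 2`. At the base
point `A`, let `S` be the span of the first `s` eigenvectors. Any competitor `B` admits a unit
vector `w ∈ S` orthogonal to the first `s - 1` eigenvectors of `B`, so
`δ_s(A) - δ_s(B) ≤ w ⬝ᵥ (A - B) *ᵥ w`. Moreover `|w i| ≤ r i`, where `r i` is the norm of the
projection of the `i`-th coordinate vector to `S`; the weights `r i * r j` do not depend on `B`,
and `∑ i, r i ^ 2 = s`. Since `δ_n ≤ δ_2`, `λ_2 = max (δ_2, -δ_n)`, and the condition passes to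
maxima.
-/

open MeasureTheory ProbabilityTheory

/-- The symmetric matrix with entries `a i j` for `i ≤ j`, completed by `a_{ji} = a_{ij}`.
The values of `a` below the diagonal are not used. -/
def symMatrix {n : ℕ} (a : Fin n → Fin n → ℝ) : Matrix (Fin n) (Fin n) ℝ :=
  Matrix.of fun i j => a (min i j) (max i j)

theorem symMatrix_isHermitian {n : ℕ} (a : Fin n → Fin n → ℝ) :
    (symMatrix a).IsHermitian := by
  ext i j
  simp [symMatrix, min_comm, max_comm]

/-- The eigenvalues of a real symmetric matrix, with multiplicity and in non-increasing order:
`delta hA i` is the `(i + 1)`-st largest one (the index `i` starts from `0`). -/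
noncomputable def delta {n : ℕ} {A : Matrix (Fin n) (Fin n) ℝ} (hA : A.IsHermitian)
    (i : Fin n) : ℝ :=
  hA.eigenvalues₀ (Fin.cast (Fintype.card_fin n).symm i)

/-- The second largest eigenvalue `δ₂(A)`. -/
noncomputable def delta2 {n : ℕ} (hn : 2 ≤ n) {A : Matrix (Fin n) (Fin n) ℝ}
    (hA : A.IsHermitian) : ℝ :=
  delta hA ⟨1, by omega⟩

/-- The smallest eigenvalue `δₙ(A)`. -/
noncomputable def deltaLast {n : ℕ} (hn : 2 ≤ n) {A : Matrix (Fin n) (Fin n) ℝ}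
    (hA : A.IsHermitian) : ℝ :=
  delta hA ⟨n - 1, by omega⟩

/-- `λ₂(A) = max (|δ₂(A)|, |δₙ(A)|)`. -/
noncomputable def lambda2 {n : ℕ} (hn : 2 ≤ n) {A : Matrix (Fin n) (Fin n) ℝ}
    (hA : A.IsHermitian) : ℝ :=
  max |delta2 hn hA| |deltaLast hn hA|

/-- `λ₂` of the random symmetric matrix with upper triangular entries `a i j`, `i ≤ j`. -/
noncomputable def randLambda2 {Ω : Type*} {n : ℕ} (hn : 2 ≤ n) (a : Fin n → Fin n → Ω → ℝ)
    (ω : Ω) : ℝ :=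
  lambda2 hn (symMatrix_isHermitian fun i j => a i j ω)

/-- `δ₂` of the random symmetric matrix with upper triangular entries `a i j`, `i ≤ j`. -/
noncomputable def randDelta2 {Ω : Type*} {n : ℕ} (hn : 2 ≤ n) (a : Fin n → Fin n → Ω → ℝ)
    (ω : Ω) : ℝ :=
  delta2 hn (symMatrix_isHermitian fun i j => a i j ω)

theorem exp_sub_sq_add_exp_neg_le_two {s : ℝ} (hs0 : 0 ≤ s) (hs1 : s ≤ 1 / 2) :
    Real.exp (s - s ^ 2) + Real.exp (-s) ≤ 2 := by
  have hcosh : Real.exp (s - s ^ 2) + Real.exp (-s) =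
      Real.exp (-(s ^ 2 / 2)) * (2 * Real.cosh (s - s ^ 2 / 2)) := by
    rw [Real.cosh_eq, mul_div_cancel₀ _ two_ne_zero, mul_add, ← Real.exp_add, ← Real.exp_add]
    ring_nf
  have hsq : (s - s ^ 2 / 2) ^ 2 ≤ s ^ 2 :=
    pow_le_pow_left₀ (by nlinarith) (by nlinarith) 2
  calc Real.exp (s - s ^ 2) + Real.exp (-s)
      ≤ Real.exp (-(s ^ 2 / 2)) * (2 * Real.exp (s ^ 2 / 2)) := by
        rw [hcosh]
        gcongr
        exact (Real.cosh_le_exp_half_sq _).trans (Real.exp_le_exp.2 (by gcongr))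
    _ = 2 := by rw [mul_left_comm, ← Real.exp_add, neg_add_cancel, Real.exp_zero, mul_one]

theorem exists_exp_le_two_sub_exp_neg {s : ℝ} (hs : 0 ≤ s) :
    ∃ θ ∈ Set.Icc (0 : ℝ) 1,
      Real.exp ((1 - θ) * s + θ ^ 2 / 4) ≤ 2 - Real.exp (-s) := by
  -- `θ = min (2 * s) 1` minimizes the exponent.
  rcases le_total s (1 / 2) with h | h
  · refine ⟨2 * s, ⟨by linarith, by linarith⟩, ?_⟩
    rw [show (1 - 2 * s) * s + (2 * s) ^ 2 / 4 = s - s ^ 2 by ring]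
    linarith [exp_sub_sq_add_exp_neg_le_two hs h]
  · refine ⟨1, ⟨zero_le_one, le_rfl⟩, ?_⟩
    have hhalf := exp_sub_sq_add_exp_neg_le_two (s := 1 / 2) (by norm_num) le_rfl
    have hmono : Real.exp (-s) ≤ Real.exp (-(1 / 2)) := by gcongr
    norm_num at hhalf ⊢
    linarith

theorem integral_exp_convexComb_le {α : Type*} [MeasurableSpace α] {ν : Measure α}
    {f g : α → ℝ} {a b l : ℝ} (hf : Integrable (fun x => Real.exp (f x)) ν)
    (hg : Integrable (fun x => Real.exp (g x)) ν)
    (hfa : ∫ x, Real.exp (f x) ∂ν ≤ Real.exp a) (hgb : ∫ x, Real.exp (g x) ∂ν ≤ Real.exp b)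
    (hl : l ∈ Set.Icc (0 : ℝ) 1) :
    ∫ x, Real.exp ((1 - l) * f x + l * g x) ∂ν ≤ Real.exp ((1 - l) * a + l * b) := by
  have hl' : 0 ≤ 1 - l := sub_nonneg.2 hl.2
  set c : ℝ := Real.exp ((1 - l) * a + l * b)
  have hconv : ∀ x, Real.exp ((1 - l) * f x + l * g x) ≤
      c * ((1 - l) * (Real.exp (-a) * Real.exp (f x)) + l * (Real.exp (-b) * Real.exp (g x))) := by
    intro x
    have h := convexOn_exp.2 (Set.mem_univ (f x - a)) (Set.mem_univ (g x - b)) hl' hl.1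
      (sub_add_cancel 1 l)
    simp only [smul_eq_mul] at h
    rw [← Real.exp_add, ← Real.exp_add, neg_add_eq_sub, neg_add_eq_sub]
    calc Real.exp ((1 - l) * f x + l * g x)
        = c * Real.exp ((1 - l) * (f x - a) + l * (g x - b)) := by
          rw [← Real.exp_add]; ring_nf
      _ ≤ _ := by gcongr
  have hf' := (hf.const_mul (Real.exp (-a))).const_mul (1 - l)
  have hg' := (hg.const_mul (Real.exp (-b))).const_mul l
  calc ∫ x, Real.exp ((1 - l) * f x + l * g x) ∂ν
      ≤ ∫ x, c * ((1 - l) * (Real.exp (-a) * Real.exp (f x)) +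
          l * (Real.exp (-b) * Real.exp (g x))) ∂ν :=
        integral_mono_of_nonneg (.of_forall fun _ => (Real.exp_pos _).le)
          ((hf'.add hg').const_mul c) (.of_forall hconv)
    _ = c * ((1 - l) * (Real.exp (-a) * ∫ x, Real.exp (f x) ∂ν) +
          l * (Real.exp (-b) * ∫ x, Real.exp (g x) ∂ν)) := by
        rw [integral_const_mul, integral_add hf' hg']
        simp only [integral_const_mul]
    _ ≤ c * ((1 - l) * (Real.exp (-a) * Real.exp a) + l * (Real.exp (-b) * Real.exp b)) := by
        have := hl.1
        gcongr
    _ = c := by simp [← Real.exp_add]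

theorem integral_mul_integral_exp_neg_le_one {α : Type*} [MeasurableSpace α] {ν : Measure α}
    [IsProbabilityMeasure ν] {U v : α → ℝ} (hU : ∀ a, 0 ≤ U a)
    (hv : BddBelow (Set.range v)) (hvi : Integrable (fun a => Real.exp (-v a)) ν)
    (h : ∀ a b, ∀ θ ∈ Set.Icc (0 : ℝ) 1,
      U a ≤ Real.exp ((1 - θ) * v a + θ * v b + θ ^ 2 / 4)) :
    (∫ a, U a ∂ν) * ∫ a, Real.exp (-v a) ∂ν ≤ 1 := by
  have : Nonempty α := ν.nonempty_of_neZero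
  set m : ℝ := ⨅ b, v b
  have hinf : ∀ a, ∀ θ ∈ Set.Icc (0 : ℝ) 1,
      U a ≤ Real.exp ((1 - θ) * v a + θ * m + θ ^ 2 / 4) := by
    intro a θ hθ
    have hclosed : IsClosed {y : ℝ | U a ≤ Real.exp ((1 - θ) * v a + θ * y + θ ^ 2 / 4)} :=
      isClosed_le continuous_const (by fun_prop)
    exact hclosed.closure_subset_iff.2 (Set.range_subset_iff.2 fun b => h a b θ hθ)
      (csInf_mem_closure (Set.range_nonempty v) hv)
  have hUle : ∀ a, U a ≤ Real.exp m * (2 - Real.exp m * Real.exp (-v a)) := by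
    intro a
    obtain ⟨θ, hθ, hexp⟩ := exists_exp_le_two_sub_exp_neg (sub_nonneg.2 (ciInf_le hv a))
    calc U a ≤ Real.exp m * Real.exp ((1 - θ) * (v a - m) + θ ^ 2 / 4) := by
          rw [← Real.exp_add]
          exact (hinf a θ hθ).trans_eq (by ring_nf)
      _ ≤ Real.exp m * (2 - Real.exp (-(v a - m))) := by gcongr
      _ = _ := by rw [← Real.exp_add, neg_sub, sub_eq_add_neg m]
  set W : ℝ := Real.exp m * ∫ a, Real.exp (-v a) ∂ν
  have hUW : ∫ a, U a ∂ν ≤ Real.exp m * (2 - W) := by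
    have hint : Integrable (fun a => 2 - Real.exp m * Real.exp (-v a)) ν :=
      (integrable_const 2).sub (hvi.const_mul _)
    calc ∫ a, U a ∂ν ≤ ∫ a, Real.exp m * (2 - Real.exp m * Real.exp (-v a)) ∂ν :=
          integral_mono_of_nonneg (.of_forall hU) (hint.const_mul _) (.of_forall hUle)
      _ = Real.exp m * (2 - W) := by
          rw [integral_const_mul, integral_sub (integrable_const 2) (hvi.const_mul _),
            integral_const_mul]
          simp [W]
  calc (∫ a, U a ∂ν) * ∫ a, Real.exp (-v a) ∂ν
      ≤ Real.exp m * (2 - W) * ∫ a, Real.exp (-v a) ∂ν :=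
        mul_le_mul_of_nonneg_right hUW (integral_nonneg fun _ => (Real.exp_pos _).le)
    _ = (2 - W) * W := by simp only [W]; ring
    _ ≤ 1 := by nlinarith [sq_nonneg (W - 1)]

section InfConv

variable {α ι : Type*} [PseudoMetricSpace α] [Fintype ι]

/-- The infimal convolution of `f` with the weighted distance `∑ i, β i * dist (x i) (y i)`, whose
weights may be negative. -/
noncomputable def weightedInfConv (β : ι → ℝ) (f : (ι → α) → ℝ) (x : ι → α) : ℝ :=
  ⨅ y, f y + ∑ i, β i * dist (x i) (y i)

/-- The weak infimal convolution: the transport functional behind Talagrand's convex distance, in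
dual form. As for `weightedInfConv`, the extrema are meaningful when `f` is bounded below and `α` is
bounded. -/
noncomputable def weakInfConv (κ : ℝ) (f : (ι → α) → ℝ) (x : ι → α) : ℝ :=
  ⨆ β : ι → ℝ, weightedInfConv β f x - κ * ∑ i, β i ^ 2

variable {f : (ι → α) → ℝ} {κ δ c : ℝ}

theorem weightedInfConv_le (hδ : ∀ a b : α, dist a b ≤ δ) (hf : BddBelow (Set.range f))
    (β : ι → ℝ) (x y : ι → α) :
    weightedInfConv β f x ≤ f y + ∑ i, β i * dist (x i) (y i) := by
  obtain ⟨c, hc⟩ := hf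
  refine ciInf_le ⟨c + ∑ i, -(|β i| * δ), ?_⟩ y
  rintro _ ⟨z, rfl⟩
  refine add_le_add (hc ⟨z, rfl⟩) (Finset.sum_le_sum fun i _ => ?_)
  calc -(|β i| * δ) ≤ -(|β i| * dist (x i) (z i)) := by gcongr; exact hδ _ _
    _ = -|β i| * dist (x i) (z i) := (neg_mul _ _).symm
    _ ≤ β i * dist (x i) (z i) := by gcongr; exact neg_abs_le _

theorem weightedInfConv_le_self (hδ : ∀ a b : α, dist a b ≤ δ) (hf : BddBelow (Set.range f))
    (β : ι → ℝ) (x : ι → α) : weightedInfConv β f x ≤ f x := by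
  simpa using weightedInfConv_le hδ hf β x x

theorem continuous_weightedInfConv (hδ : ∀ a b : α, dist a b ≤ δ) (hf : BddBelow (Set.range f))
    (β : ι → ℝ) : Continuous (weightedInfConv β f) := by
  refine (LipschitzWith.of_le_add_mul (∑ i, ‖β i‖₊) fun x x' => ?_).continuous
  have : Nonempty (ι → α) := ⟨x⟩
  rw [← sub_le_iff_le_add]
  refine le_ciInf fun y => sub_le_iff_le_add.2 ((weightedInfConv_le hδ hf β x y).trans ?_)
  rw [add_assoc]
  gcongr
  push_cast
  rw [Finset.sum_mul, ← Finset.sum_add_distrib]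
  gcongr with i
  calc β i * dist (x i) (y i)
      = β i * dist (x' i) (y i) + β i * (dist (x i) (y i) - dist (x' i) (y i)) := by ring
    _ ≤ β i * dist (x' i) (y i) + |β i| * |dist (x i) (y i) - dist (x' i) (y i)| := by
      rw [← abs_mul]
      gcongr
      exact le_abs_self _
    _ ≤ β i * dist (x' i) (y i) + ‖β i‖ * dist x x' := by
      gcongr
      · exact le_rfl
      · exact (abs_dist_sub_le _ _ _).trans (dist_le_pi_dist x x' i)

theorem bddAbove_range_weakInfConv (hκ : 0 ≤ κ) (hδ : ∀ a b : α, dist a b ≤ δ)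
    (hf : BddBelow (Set.range f)) (x : ι → α) :
    BddAbove (Set.range fun β : ι → ℝ => weightedInfConv β f x - κ * ∑ i, β i ^ 2) := by
  refine ⟨f x, ?_⟩
  rintro _ ⟨β, rfl⟩
  exact (sub_le_self _ (by positivity)).trans (weightedInfConv_le_self hδ hf β x)

theorem weakInfConv_le_self (hκ : 0 ≤ κ) (hδ : ∀ a b : α, dist a b ≤ δ)
    (hf : BddBelow (Set.range f)) (x : ι → α) : weakInfConv κ f x ≤ f x :=
  ciSup_le fun β => (sub_le_self _ (by positivity)).trans (weightedInfConv_le_self hδ hf β x)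

theorem le_weakInfConv (hκ : 0 ≤ κ) (hδ : ∀ a b : α, dist a b ≤ δ) (hf : ∀ y, c ≤ f y)
    (x : ι → α) : c ≤ weakInfConv κ f x := by
  have : Nonempty (ι → α) := ⟨x⟩
  refine le_ciSup_of_le (bddAbove_range_weakInfConv hκ hδ ⟨c, Set.forall_mem_range.2 hf⟩ x) 0 ?_
  simpa [weightedInfConv] using le_ciInf hf

theorem abs_weakInfConv_le (hκ : 0 ≤ κ) (hδ : ∀ a b : α, dist a b ≤ δ) (hf : ∀ y, |f y| ≤ c)
    (x : ι → α) : |weakInfConv κ f x| ≤ c :=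
  have hlow := fun y => (abs_le.1 (hf y)).1
  abs_le.2 ⟨le_weakInfConv hκ hδ hlow x,
    (weakInfConv_le_self hκ hδ ⟨-c, Set.forall_mem_range.2 hlow⟩ x).trans (abs_le.1 (hf x)).2⟩

theorem measurable_weakInfConv [SecondCountableTopology α] [MeasurableSpace α] [BorelSpace α]
    (hκ : 0 ≤ κ) (hδ : ∀ a b : α, dist a b ≤ δ) (hf : BddBelow (Set.range f)) :
    Measurable (weakInfConv κ f) :=
  (lowerSemicontinuous_ciSup (bddAbove_range_weakInfConv hκ hδ hf) fun β =>
    ((continuous_weightedInfConv hδ hf β).sub continuous_const).lowerSemicontinuous).measurable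

end InfConv

section Product

variable {α : Type*} [PseudoMetricSpace α] {m : ℕ} {f : (Fin (m + 1) → α) → ℝ} {δ θ : ℝ}

theorem bddBelow_range_cons {α : Type*} {f : (Fin (m + 1) → α) → ℝ}
    (hf : BddBelow (Set.range f)) (a : α) :
    BddBelow (Set.range fun z : Fin m → α => f (Fin.cons a z)) :=
  hf.mono (Set.range_comp_subset_range _ f)

theorem weightedInfConv_cons_le (hδ : ∀ a b : α, dist a b ≤ δ) (hf : BddBelow (Set.range f))
    (β : Fin (m + 1) → ℝ) (a b : α) (y : Fin m → α) :
    weightedInfConv β f (Fin.cons a y) ≤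
      weightedInfConv (Fin.tail β) (fun z => f (Fin.cons b z)) y + β 0 * dist a b := by
  have : Nonempty (Fin m → α) := ⟨y⟩
  refine sub_le_iff_le_add.1 (le_ciInf fun z => sub_le_iff_le_add.2 ?_)
  refine (weightedInfConv_le hδ hf β (Fin.cons a y) (Fin.cons b z)).trans_eq ?_
  simp only [Fin.sum_univ_succ, Fin.cons_zero, Fin.cons_succ, Fin.tail]
  ring

theorem weakInfConv_cons_le (hδ : ∀ a b : α, dist a b ≤ δ) (hf : BddBelow (Set.range f))
    (hθ : θ ∈ Set.Icc (0 : ℝ) 1) (a b : α) (y : Fin m → α) :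
    weakInfConv (δ ^ 2) f (Fin.cons a y) ≤
      (1 - θ) * weakInfConv (δ ^ 2) (fun z => f (Fin.cons a z)) y +
        θ * weakInfConv (δ ^ 2) (fun z => f (Fin.cons b z)) y + θ ^ 2 / 4 := by
  refine ciSup_le fun β => ?_
  have hle : ∀ b : α, weightedInfConv (Fin.tail β) (fun z => f (Fin.cons b z)) y ≤
      weakInfConv (δ ^ 2) (fun z => f (Fin.cons b z)) y + δ ^ 2 * ∑ i, Fin.tail β i ^ 2 := fun b =>
    sub_le_iff_le_add.1 <| le_ciSup
      (bddAbove_range_weakInfConv (sq_nonneg δ) hδ (bddBelow_range_cons hf b) y) (Fin.tail β)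
  have hstay := (weightedInfConv_cons_le hδ hf β a a y).trans (add_le_add_left (hle a) _)
  have hmove := (weightedInfConv_cons_le hδ hf β a b y).trans (add_le_add_left (hle b) _)
  have hcost : θ * (β 0 * dist a b) ≤ δ ^ 2 * β 0 ^ 2 + θ ^ 2 / 4 := by
    have hdist : dist a b ^ 2 ≤ δ ^ 2 := pow_le_pow_left₀ dist_nonneg (hδ a b) 2
    nlinarith [sq_nonneg (β 0 * dist a b - θ / 2),
      mul_le_mul_of_nonneg_right hdist (sq_nonneg (β 0))]
  rw [dist_self, mul_zero, add_zero] at hstay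
  rw [Fin.sum_univ_succ]
  change _ - δ ^ 2 * (β 0 ^ 2 + ∑ i, Fin.tail β i ^ 2) ≤ _
  linarith [mul_le_mul_of_nonneg_left hstay (sub_nonneg.2 hθ.2),
    mul_le_mul_of_nonneg_left hmove hθ.1]

end Product

section Tensorization

theorem measurable_finCons {α : Type*} [MeasurableSpace α] {m : ℕ} :
    Measurable fun p : α × (Fin m → α) => (Fin.cons p.1 p.2 : Fin (m + 1) → α) :=
  measurable_pi_iff.2 <| Fin.cases measurable_fst fun i =>
    (measurable_pi_apply i).comp measurable_snd

theorem integral_pi_finCons {α : Type*} [MeasurableSpace α] {m : ℕ}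
    (ν : Fin (m + 1) → Measure α) [∀ i, SigmaFinite (ν i)] (g : (Fin (m + 1) → α) → ℝ) :
    ∫ x, g x ∂Measure.pi ν =
      ∫ p, g (Fin.cons p.1 p.2) ∂(ν 0).prod (Measure.pi fun i => ν i.succ) := by
  rw [← (measurePreserving_piFinSuccAbove ν 0).symm.integral_comp']
  simp [MeasurableEquiv.piFinSuccAbove, Fin.consEquiv]

theorem integrable_exp_of_abs_le {X : Type*} [MeasurableSpace X] {ν : Measure X}
    [IsFiniteMeasure ν] {g : X → ℝ} (hg : Measurable g) {c : ℝ} (hc : ∀ x, |g x| ≤ c) :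
    Integrable (fun x => Real.exp (g x)) ν :=
  .of_mem_Icc 0 (Real.exp c) hg.exp.aemeasurable <| .of_forall fun x =>
    ⟨(Real.exp_pos _).le, Real.exp_le_exp.2 (le_of_abs_le (hc x))⟩

variable {α : Type*} [PseudoMetricSpace α] [SecondCountableTopology α] [MeasurableSpace α]
  [BorelSpace α] {m : ℕ} {δ c : ℝ}

theorem integral_exp_weakInfConv_finCons_le (hδ : ∀ a b : α, dist a b ≤ δ)
    (π : Measure (Fin m → α)) [IsFiniteMeasure π] {f : (Fin (m + 1) → α) → ℝ} (hf : ∀ x, |f x| ≤ c)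
    {v : α → ℝ}
    (hv : ∀ a, ∫ y, Real.exp (weakInfConv (δ ^ 2) (fun z => f (Fin.cons a z)) y) ∂π ≤
      Real.exp (v a)) (a b : α) {θ : ℝ} (hθ : θ ∈ Set.Icc (0 : ℝ) 1) :
    ∫ y, Real.exp (weakInfConv (δ ^ 2) f (Fin.cons a y)) ∂π ≤
      Real.exp ((1 - θ) * v a + θ * v b + θ ^ 2 / 4) := by
  have hlow {k : ℕ} {g : (Fin k → α) → ℝ} (hg : ∀ x, |g x| ≤ c) : BddBelow (Set.range g) :=
    ⟨-c, Set.forall_mem_range.2 fun x => (abs_le.1 (hg x)).1⟩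
  set Q : α → (Fin m → α) → ℝ := fun a => weakInfConv (δ ^ 2) fun z => f (Fin.cons a z)
  have hQm (a : α) : Measurable (Q a) :=
    measurable_weakInfConv (sq_nonneg δ) hδ (hlow fun y => hf (Fin.cons a y))
  have hQc (a : α) (y : Fin m → α) : |Q a y| ≤ c :=
    abs_weakInfConv_le (sq_nonneg δ) hδ (fun y => hf _) y
  have hmix (y : Fin m → α) : |(1 - θ) * Q a y + θ * Q b y| ≤ c := by
    obtain ⟨ha, ha'⟩ := abs_le.1 (hQc a y)
    obtain ⟨hb, hb'⟩ := abs_le.1 (hQc b y)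
    have := hθ.1
    have := hθ.2
    exact abs_le.2 ⟨by nlinarith, by nlinarith⟩
  calc ∫ y, Real.exp (weakInfConv (δ ^ 2) f (Fin.cons a y)) ∂π
      ≤ ∫ y, Real.exp ((1 - θ) * Q a y + θ * Q b y) * Real.exp (θ ^ 2 / 4) ∂π := by
        refine integral_mono_of_nonneg (.of_forall fun _ => (Real.exp_pos _).le)
          ((integrable_exp_of_abs_le (((hQm a).const_mul _).add ((hQm b).const_mul _))
            hmix).mul_const _) (.of_forall fun y => ?_)
        simp only [← Real.exp_add]
        exact Real.exp_le_exp.2 (weakInfConv_cons_le hδ (hlow hf) hθ a b y)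
    _ = (∫ y, Real.exp ((1 - θ) * Q a y + θ * Q b y) ∂π) * Real.exp (θ ^ 2 / 4) :=
        integral_mul_const _ _
    _ ≤ Real.exp ((1 - θ) * v a + θ * v b) * Real.exp (θ ^ 2 / 4) := by
        gcongr
        exact integral_exp_convexComb_le (integrable_exp_of_abs_le (hQm a) (hQc a))
          (integrable_exp_of_abs_le (hQm b) (hQc b)) (hv a) (hv b) hθ
    _ = _ := (Real.exp_add _ _).symm

theorem integral_exp_weakInfConv_prod_mul_le_one (hδ : ∀ a b : α, dist a b ≤ δ)
    (ν : Measure α) [IsProbabilityMeasure ν] (π : Measure (Fin m → α)) [IsProbabilityMeasure π]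
    {f : (Fin (m + 1) → α) → ℝ} (hfm : Measurable f) (hf : ∀ x, |f x| ≤ c)
    (hsection : ∀ a, (∫ y, Real.exp (weakInfConv (δ ^ 2) (fun z => f (Fin.cons a z)) y) ∂π) *
      ∫ y, Real.exp (-f (Fin.cons a y)) ∂π ≤ 1) :
    (∫ p, Real.exp (weakInfConv (δ ^ 2) f (Fin.cons p.1 p.2)) ∂ν.prod π) *
      ∫ p, Real.exp (-f (Fin.cons p.1 p.2)) ∂ν.prod π ≤ 1 := by
  have hneg : Integrable (fun p : α × (Fin m → α) => Real.exp (-f (Fin.cons p.1 p.2)))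
      (ν.prod π) :=
    integrable_exp_of_abs_le (hfm.comp measurable_finCons).neg fun p => (abs_neg _).trans_le (hf _)
  have hneg' (a : α) : Integrable (fun y => Real.exp (-f (Fin.cons a y))) π :=
    integrable_exp_of_abs_le (hfm.comp (measurable_finCons.comp measurable_prodMk_left)).neg
      fun y => (abs_neg _).trans_le (hf _)
  have hQ : Integrable (fun p : α × (Fin m → α) =>
      Real.exp (weakInfConv (δ ^ 2) f (Fin.cons p.1 p.2))) (ν.prod π) :=
    integrable_exp_of_abs_le
      ((measurable_weakInfConv (sq_nonneg δ) hδ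
        ⟨-c, Set.forall_mem_range.2 fun x => (abs_le.1 (hf x)).1⟩).comp measurable_finCons)
      fun p => abs_weakInfConv_le (sq_nonneg δ) hδ hf _
  set v : α → ℝ := fun a => -Real.log (∫ y, Real.exp (-f (Fin.cons a y)) ∂π)
  have hv (a : α) : ∫ y, Real.exp (-f (Fin.cons a y)) ∂π = Real.exp (-v a) := by
    rw [neg_neg, Real.exp_log (integral_exp_pos (hneg' a))]
  have hvc : BddBelow (Set.range v) := by
    refine ⟨-c, Set.forall_mem_range.2 fun a => neg_le_neg ?_⟩
    rw [← Real.exp_le_exp, Real.exp_log (integral_exp_pos (hneg' a))]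
    refine (integral_mono (hneg' a) (integrable_const (Real.exp c)) fun y => ?_).trans_eq (by simp)
    exact Real.exp_le_exp.2 ((neg_le_abs _).trans (hf _))
  rw [integral_prod _ hQ, integral_prod _ hneg]
  simp only [hv]
  refine integral_mul_integral_exp_neg_le_one
    (fun a => integral_nonneg fun y => (Real.exp_pos _).le) hvc
    (by simpa only [hv] using hneg.integral_prod_left) fun a b θ hθ =>
      integral_exp_weakInfConv_finCons_le hδ π hf (fun a => ?_) a b hθ
  have h := hsection a
  rwa [hv, Real.exp_neg, ← div_eq_mul_inv, div_le_one (Real.exp_pos _)] at h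

theorem integral_exp_weakInfConv_mul_le_one (hδ : ∀ a b : α, dist a b ≤ δ)
    (ν : Fin m → Measure α) [∀ i, IsProbabilityMeasure (ν i)] {f : (Fin m → α) → ℝ}
    (hfm : Measurable f) (hf : ∀ x, |f x| ≤ c) :
    (∫ x, Real.exp (weakInfConv (δ ^ 2) f x) ∂Measure.pi ν) *
      ∫ x, Real.exp (-f x) ∂Measure.pi ν ≤ 1 := by
  induction m with
  | zero =>
    rw [Measure.pi_of_empty, integral_dirac, integral_dirac, ← Real.exp_add, Real.exp_le_one_iff]
    linarith [weakInfConv_le_self (sq_nonneg δ) hδ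
      ⟨-c, Set.forall_mem_range.2 fun x => (abs_le.1 (hf x)).1⟩ isEmptyElim]
  | succ m ih =>
    rw [integral_pi_finCons, integral_pi_finCons]
    exact integral_exp_weakInfConv_prod_mul_le_one hδ _ _ hfm hf fun a =>
      ih _ (hfm.comp (measurable_finCons.comp measurable_prodMk_left)) fun y => hf _

end Tensorization

section WeightedLipschitz

variable {α ι : Type*} [PseudoMetricSpace α] [Fintype ι] {V W : NNReal} {F G : (ι → α) → ℝ}

/-- The one-sided Lipschitz condition of Talagrand's inequality: from every base point `x`, the
decrease of `F` is bounded by a weighted distance whose weights may depend on `x`, but have sum of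
squares at most `V`. -/
def WeightedLipschitz (V : NNReal) (F : (ι → α) → ℝ) : Prop :=
  ∀ x, ∃ β : ι → ℝ, ∑ i, β i ^ 2 ≤ V ∧ ∀ y, F x - F y ≤ ∑ i, β i * dist (x i) (y i)

namespace WeightedLipschitz

theorem mono (hF : WeightedLipschitz V F) (h : V ≤ W) : WeightedLipschitz W F := fun x =>
  let ⟨β, hβ, hx⟩ := hF x
  ⟨β, hβ.trans (NNReal.coe_le_coe.2 h), hx⟩

theorem sup (hF : WeightedLipschitz V F) (hG : WeightedLipschitz V G) :
    WeightedLipschitz V (F ⊔ G) := by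
  intro x
  rcases le_total (G x) (F x) with h | h
  · obtain ⟨β, hβ, hx⟩ := hF x
    refine ⟨β, hβ, fun y => (sub_le_sub_left (le_sup_left (b := G y)) _).trans ?_⟩
    simpa only [Pi.sup_apply, sup_of_le_left h] using hx y
  · obtain ⟨β, hβ, hx⟩ := hG x
    refine ⟨β, hβ, fun y => (sub_le_sub_left (le_sup_right (a := F y)) _).trans ?_⟩
    simpa only [Pi.sup_apply, sup_of_le_right h] using hx y

theorem comp_equiv {κ : Type*} [Fintype κ] (hF : WeightedLipschitz V F) (e : ι ≃ κ) :
    WeightedLipschitz V fun x : κ → α => F (x ∘ e) := by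
  intro x
  obtain ⟨β, hβ, hx⟩ := hF (x ∘ e)
  refine ⟨β ∘ e.symm, ?_, fun y => (hx (y ∘ e)).trans_eq ?_⟩
  · simpa [← e.sum_comp] using hβ
  · simp [← e.sum_comp]

theorem comp_isometry {γ : Type*} [PseudoMetricSpace γ] (hF : WeightedLipschitz V F) {φ : γ → α}
    (hφ : Isometry φ) : WeightedLipschitz V fun x : ι → γ => F (φ ∘ x) := by
  intro x
  obtain ⟨β, hβ, hx⟩ := hF (φ ∘ x)
  refine ⟨β, hβ, fun y => (hx (φ ∘ y)).trans_eq ?_⟩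
  simp only [Function.comp_apply, hφ.dist_eq]

theorem lipschitzWith (hF : WeightedLipschitz V F) :
    LipschitzWith (Fintype.card ι * NNReal.sqrt V) F := by
  refine LipschitzWith.of_le_add_mul _ fun x y => sub_le_iff_le_add'.1 ?_
  obtain ⟨β, hβ, hx⟩ := hF x
  have hβ' (i : ι) : β i ≤ √V := Real.le_sqrt_of_sq_le <|
    (Finset.single_le_sum (fun j _ => sq_nonneg (β j)) (Finset.mem_univ i)).trans hβ
  calc F x - F y ≤ ∑ i, β i * dist (x i) (y i) := hx y
    _ ≤ ∑ _i : ι, √V * dist x y := by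
        gcongr with i
        · exact hβ' i
        · exact dist_le_pi_dist x y i
    _ = _ := by simp [mul_assoc]

theorem exists_abs_le (hF : WeightedLipschitz V F) {δ : ℝ} (hδ : ∀ a b : α, dist a b ≤ δ) :
    ∃ c, ∀ x, |F x| ≤ c := by
  have : BoundedSpace α := ⟨Metric.isBounded_iff.2 ⟨δ, fun a _ b _ => hδ a b⟩⟩
  obtain ⟨c, hc⟩ :=
    (hF.lipschitzWith.isBounded_image (Bornology.IsBounded.all Set.univ)).exists_norm_le
  exact ⟨c, fun x => hc _ ⟨x, trivial, rfl⟩⟩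

theorem le_weakInfConv (hF : WeightedLipschitz V F) {δ : ℝ} (hδ : ∀ a b : α, dist a b ≤ δ)
    {t : ℝ} (ht : 0 ≤ t) (x : ι → α) :
    t * F x - δ ^ 2 * V * t ^ 2 ≤ weakInfConv (δ ^ 2) (fun y => t * F y) x := by
  have : Nonempty (ι → α) := ⟨x⟩
  obtain ⟨c, hc⟩ := hF.exists_abs_le hδ
  obtain ⟨β, hβ, hx⟩ := hF x
  have hbdd : BddBelow (Set.range fun y => t * F y) :=
    ⟨-(t * c), Set.forall_mem_range.2 fun y => by
      rw [← mul_neg]; exact mul_le_mul_of_nonneg_left (abs_le.1 (hc y)).1 ht⟩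
  have hinf : t * F x ≤ weightedInfConv (fun i => t * β i) (fun y => t * F y) x := by
    refine le_ciInf fun y => ?_
    simp only [mul_assoc, ← Finset.mul_sum]
    rw [← mul_add]
    exact mul_le_mul_of_nonneg_left (sub_le_iff_le_add'.1 (hx y)) ht
  refine le_trans ?_ (le_ciSup (bddAbove_range_weakInfConv (sq_nonneg δ) hδ hbdd x)
    fun i => t * β i)
  have hcost : δ ^ 2 * ∑ i, (t * β i) ^ 2 ≤ δ ^ 2 * V * t ^ 2 := by
    simp only [mul_pow, ← Finset.mul_sum]
    calc δ ^ 2 * (t ^ 2 * ∑ i, β i ^ 2) ≤ δ ^ 2 * (t ^ 2 * V) := by gcongr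
      _ = _ := by ring
  exact sub_le_sub hinf hcost

end WeightedLipschitz
end WeightedLipschitz

section Concentration

variable {Ω : Type*} [MeasurableSpace Ω] {μ : Measure Ω} [IsProbabilityMeasure μ]

theorem hasSubgaussianMGF_of_mgf_mul_mgf_neg_le {Y : Ω → ℝ} {c : NNReal}
    (hY : ∀ t, Integrable (fun ω => Real.exp (t * Y ω)) μ)
    (h : ∀ t, mgf Y μ t * mgf Y μ (-t) ≤ Real.exp (c * t ^ 2 / 2)) :
    HasSubgaussianMGF (fun ω => Y ω - ∫ ω', Y ω' ∂μ) c μ := by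
  have hexp (t : ℝ) (ω : Ω) : Real.exp (t * (Y ω - ∫ ω', Y ω' ∂μ)) =
      Real.exp (t * Y ω) * Real.exp (-t * ∫ ω', Y ω' ∂μ) := by
    rw [← Real.exp_add]
    ring_nf
  refine ⟨fun t => by simpa only [hexp] using (hY t).mul_const _, fun t => ?_⟩
  have hYi : Integrable Y μ := integrable_of_mem_interior_integrableExpSet <| by
    rw [Set.eq_univ_of_forall (s := integrableExpSet Y μ) hY, interior_univ]
    trivial
  have hjensen : Real.exp (-t * ∫ ω, Y ω ∂μ) ≤ mgf Y μ (-t) := by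
    rw [← integral_const_mul]
    exact convexOn_exp.map_integral_le Real.continuous_exp.continuousOn isClosed_univ
      (.of_forall fun _ => Set.mem_univ _) (hYi.const_mul _) (hY _)
  calc mgf (fun ω => Y ω - ∫ ω', Y ω' ∂μ) μ t
      = mgf Y μ t * Real.exp (-t * ∫ ω, Y ω ∂μ) := by
        simp only [mgf, hexp, integral_mul_const]
    _ ≤ mgf Y μ t * mgf Y μ (-t) := mul_le_mul_of_nonneg_left hjensen mgf_nonneg
    _ ≤ Real.exp (c * t ^ 2 / 2) := h t

theorem measureReal_abs_ge_le {X : Ω → ℝ} {c : NNReal}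
    (h : HasSubgaussianMGF X c μ) {t : ℝ} (ht : 0 ≤ t) (htc : 4 * c ≤ t ^ 2) :
    μ.real {ω | t ≤ |X ω|} ≤ Real.exp (-t ^ 2 / (4 * c)) := by
  have hsplit : {ω | t ≤ |X ω|} ⊆ {ω | t ≤ X ω} ∪ {ω | t ≤ (-X) ω} :=
    fun ω (hω : t ≤ |X ω|) => (le_abs.1 hω : t ≤ X ω ∨ t ≤ -X ω)
  rcases eq_or_ne c 0 with rfl | hc
  · simp
  have : (0 : ℝ) < c := by positivity
  have htwo : (2 : ℝ) ≤ Real.exp (t ^ 2 / (4 * c)) := by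
    have := Real.add_one_le_exp (t ^ 2 / (4 * c))
    linarith [(one_le_div (by positivity)).2 htc]
  calc μ.real {ω | t ≤ |X ω|}
      ≤ μ.real {ω | t ≤ X ω} + μ.real {ω | t ≤ (-X) ω} :=
        (measureReal_mono hsplit).trans (measureReal_union_le _ _)
    _ ≤ Real.exp (-t ^ 2 / (2 * c)) + Real.exp (-t ^ 2 / (2 * c)) :=
        add_le_add (h.measure_ge_le ht) (h.neg.measure_ge_le ht)
    _ = 2 * Real.exp (-t ^ 2 / (2 * c)) := (two_mul _).symm
    _ ≤ Real.exp (t ^ 2 / (4 * c)) * Real.exp (-t ^ 2 / (2 * c)) := by gcongr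
    _ = Real.exp (-t ^ 2 / (4 * c)) := by
        rw [← Real.exp_add]
        congr 1
        field

namespace WeightedLipschitz

variable {α ι : Type*} [PseudoMetricSpace α] [SecondCountableTopology α] [MeasurableSpace α]
  [BorelSpace α] [Fintype ι] {V : NNReal}

theorem mgf_pi_mul_mgf_pi_neg_le {δ : ℝ} (hδ : ∀ a b : α, dist a b ≤ δ) {m : ℕ}
    (ν : Fin m → Measure α) [∀ i, IsProbabilityMeasure (ν i)] {F : (Fin m → α) → ℝ}
    (hF : WeightedLipschitz V F) (t : ℝ) :
    mgf F (Measure.pi ν) t * mgf F (Measure.pi ν) (-t) ≤ Real.exp (δ ^ 2 * V * t ^ 2) := by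
  wlog ht : 0 ≤ t generalizing t
  · simpa [mul_comm] using this (-t) (by linarith)
  obtain ⟨c, hc⟩ := hF.exists_abs_le hδ
  have htc (x : Fin m → α) : |t * F x| ≤ t * c := by
    rw [abs_mul, abs_of_nonneg ht]
    exact mul_le_mul_of_nonneg_left (hc x) ht
  have hle : mgf F (Measure.pi ν) t ≤ Real.exp (δ ^ 2 * V * t ^ 2) *
      ∫ x, Real.exp (weakInfConv (δ ^ 2) (fun y => t * F y) x) ∂Measure.pi ν := by
    rw [← integral_const_mul]
    refine integral_mono_of_nonneg (.of_forall fun _ => (Real.exp_pos _).le)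
      ((integrable_exp_of_abs_le (measurable_weakInfConv (sq_nonneg δ) hδ
        ⟨-(t * c), Set.forall_mem_range.2 fun x => (abs_le.1 (htc x)).1⟩)
        (abs_weakInfConv_le (sq_nonneg δ) hδ htc)).const_mul _) (.of_forall fun x => ?_)
    simp only [← Real.exp_add]
    exact Real.exp_le_exp.2 (sub_le_iff_le_add'.1 (hF.le_weakInfConv hδ ht x))
  have hdual := integral_exp_weakInfConv_mul_le_one hδ ν
    (hF.lipschitzWith.continuous.measurable.const_mul t) htc
  simp only [← neg_mul] at hdual
  refine (mul_le_mul_of_nonneg_right hle mgf_nonneg).trans ?_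
  rw [mul_assoc]
  exact mul_le_of_le_one_right (Real.exp_pos _).le hdual

theorem hasSubgaussianMGF {δ : NNReal} (hδ : ∀ a b : α, dist a b ≤ δ) {F : (ι → α) → ℝ}
    (hF : WeightedLipschitz V F) {X : ι → Ω → α} (hX : ∀ i, AEMeasurable (X i) μ)
    (hind : iIndepFun X μ) :
    HasSubgaussianMGF (fun ω => F (fun i => X i ω) - ∫ ω', F (fun i => X i ω') ∂μ)
      (2 * δ ^ 2 * V) μ := by
  have hXm : AEMeasurable (fun ω i => X i ω) μ := aemeasurable_pi_lambda _ hX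
  have hFm : Measurable F := hF.lipschitzWith.continuous.measurable
  obtain ⟨c, hc⟩ := hF.exists_abs_le hδ
  refine hasSubgaussianMGF_of_mgf_mul_mgf_neg_le (fun t => ?_) fun t => ?_
  · exact integrable_exp_mul_of_mem_Icc (hFm.comp_aemeasurable hXm)
      (.of_forall fun ω => abs_le.1 (hc fun i => X i ω))
  let e := Fintype.equivFin ι
  have hXe := fun k => hX (e.symm k)
  have hprob := fun k => Measure.isProbabilityMeasure_map (hXe k)
  have hlaw (s : ℝ) : mgf (fun ω => F fun i => X i ω) μ s =
      mgf (fun x => F (x ∘ e)) (Measure.pi fun k => μ.map (X (e.symm k))) s := by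
    rw [← (hind.precomp e.symm.injective).map_fun_eq_pi_map hXe,
      mgf_map (aemeasurable_pi_lambda _ hXe)]
    · simp [Function.comp_def]
    · exact (((hF.comp_equiv e).lipschitzWith.continuous.const_smul s).rexp).aestronglyMeasurable
  rw [hlaw, hlaw]
  refine ((hF.comp_equiv e).mgf_pi_mul_mgf_pi_neg_le hδ _ t).trans_eq ?_
  push_cast
  ring_nf

theorem hasSubgaussianMGF_of_mem_Icc {F : (ι → ℝ) → ℝ} (hF : WeightedLipschitz V F) {a b : ℝ}
    (hab : a ≤ b) {X : ι → Ω → ℝ} (hX : ∀ i, AEMeasurable (X i) μ) (hind : iIndepFun X μ)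
    (hb : ∀ i, ∀ᵐ ω ∂μ, X i ω ∈ Set.Icc a b) :
    HasSubgaussianMGF (fun ω => F (fun i => X i ω) - ∫ ω', F (fun i => X i ω') ∂μ)
      (2 * ‖b - a‖₊ ^ 2 * V) μ := by
  have hproj := (continuous_projIcc (h := hab)).measurable
  have hsub := (hF.comp_isometry (isometry_subtype_coe (s := Set.Icc a b))).hasSubgaussianMGF
    (δ := ‖b - a‖₊) (fun x y => ?_) (fun i => hproj.comp_aemeasurable (hX i))
    (hind.comp _ fun _ => hproj)
  · have hae : (fun ω => F fun i => Set.projIcc a b hab (X i ω)) =ᵐ[μ]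
        fun ω => F fun i => X i ω := by
      filter_upwards [ae_all_iff.2 hb] with ω hω
      congr 1
      funext i
      exact Set.projIcc_of_mem hab (hω i) ▸ rfl
    change HasSubgaussianMGF (fun ω => F (fun i => Set.projIcc a b hab (X i ω)) -
      ∫ ω', F (fun i => Set.projIcc a b hab (X i ω')) ∂μ) _ μ at hsub
    rw [integral_congr_ae hae] at hsub
    exact hsub.congr (hae.sub .rfl)
  · exact (Real.dist_le_of_mem_Icc x.2 y.2).trans (le_abs_self _)

theorem integrable_of_mem_Icc {F : (ι → ℝ) → ℝ} (hF : WeightedLipschitz V F) {a b : ℝ}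
    (hab : a ≤ b) {X : ι → Ω → ℝ} (hX : ∀ i, AEMeasurable (X i) μ) (hind : iIndepFun X μ)
    (hb : ∀ i, ∀ᵐ ω ∂μ, X i ω ∈ Set.Icc a b) :
    Integrable (fun ω => F fun i => X i ω) μ := by
  have hcentered := (hF.hasSubgaussianMGF_of_mem_Icc hab hX hind hb).integrable
  exact (hcentered.add (integrable_const (∫ ω, F (fun i => X i ω) ∂μ))).congr
    (.of_forall fun _ => sub_add_cancel _ _)

theorem measureReal_abs_sub_integral_ge_le {F : (ι → ℝ) → ℝ} (hF : WeightedLipschitz V F)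
    {a b : ℝ} (hab : a ≤ b) {X : ι → Ω → ℝ} (hX : ∀ i, AEMeasurable (X i) μ)
    (hind : iIndepFun X μ) (hb : ∀ i, ∀ᵐ ω ∂μ, X i ω ∈ Set.Icc a b) {t : ℝ} (ht : 0 ≤ t)
    (htV : 8 * (b - a) ^ 2 * V ≤ t ^ 2) :
    μ.real {ω | t ≤ |F (fun i => X i ω) - ∫ ω', F (fun i => X i ω') ∂μ|} ≤
      Real.exp (-t ^ 2 / (8 * (b - a) ^ 2 * V)) := by
  have hc : 4 * ((2 * ‖b - a‖₊ ^ 2 * V : NNReal) : ℝ) = 8 * (b - a) ^ 2 * V := by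
    push_cast
    rw [Real.norm_eq_abs, sq_abs]
    ring
  rw [← hc] at htV ⊢
  exact measureReal_abs_ge_le (hF.hasSubgaussianMGF_of_mem_Icc hab hX hind hb) ht htV

end WeightedLipschitz

end Concentration

section QuadraticForm

variable {ι : Type*} [LinearOrder ι]

/-- The symmetric matrix with prescribed entries on and above the diagonal. Unlike in `symMatrix`,
its parameters are exactly the independent entries. -/
def upperMatrix (x : {e : ι × ι // e.1 ≤ e.2} → ℝ) : Matrix ι ι ℝ :=
  Matrix.of fun i j => x ⟨(min i j, max i j), min_le_max⟩

theorem upperMatrix_isHermitian (x : {e : ι × ι // e.1 ≤ e.2} → ℝ) :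
    (upperMatrix x).IsHermitian :=
  Matrix.IsHermitian.ext fun i j => by simp [upperMatrix, min_comm, max_comm]

variable [Fintype ι]

theorem sum_prod_eq_sum_upper {g : ι × ι → ℝ} (hg : ∀ p, g p.swap = g p) :
    ∑ p, g p = ∑ e : {e : ι × ι // e.1 ≤ e.2}, (if e.1.1 = e.1.2 then 1 else 2) * g e := by
  have hswap : ∑ p, (if p.2 < p.1 then g p else 0) = ∑ p, if p.1 < p.2 then g p else 0 := by
    rw [← (Equiv.prodComm ι ι).sum_comp]
    simp [hg]
  calc ∑ p, g p = ∑ p, ((if p.1 ≤ p.2 then g p else 0) + if p.2 < p.1 then g p else 0) := by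
        refine Finset.sum_congr rfl fun p _ => ?_
        split_ifs <;> grind
    _ = ∑ p, ((if p.1 ≤ p.2 then g p else 0) + if p.1 < p.2 then g p else 0) := by
        rw [Finset.sum_add_distrib, hswap, ← Finset.sum_add_distrib]
    _ = ∑ p : ι × ι with p.1 ≤ p.2, (if p.1 = p.2 then 1 else 2) * g p := by
        rw [Finset.sum_filter]
        refine Finset.sum_congr rfl fun p _ => ?_
        split_ifs <;> grind
    _ = _ := Finset.sum_subtype _ (by simp) _

theorem abs_dotProduct_upperMatrix_sub_le {w r : ι → ℝ} (hw : ∀ i, |w i| ≤ r i)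
    (x y : {e : ι × ι // e.1 ≤ e.2} → ℝ) :
    |w ⬝ᵥ (upperMatrix x).mulVec w - w ⬝ᵥ (upperMatrix y).mulVec w| ≤
      ∑ e : {e : ι × ι // e.1 ≤ e.2},
        (if e.1.1 = e.1.2 then 1 else 2) * (r e.1.1 * r e.1.2) * dist (x e) (y e) := by
  let d : ι × ι → ℝ := fun p =>
    dist (x ⟨(min p.1 p.2, max p.1 p.2), min_le_max⟩) (y ⟨(min p.1 p.2, max p.1 p.2), min_le_max⟩)
  calc |w ⬝ᵥ (upperMatrix x).mulVec w - w ⬝ᵥ (upperMatrix y).mulVec w|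
      = |∑ p : ι × ι, w p.1 * w p.2 * (upperMatrix x p.1 p.2 - upperMatrix y p.1 p.2)| := by
        rw [← dotProduct_sub, ← Matrix.sub_mulVec, Fintype.sum_prod_type]
        simp only [dotProduct, Matrix.mulVec, Finset.mul_sum, Matrix.sub_apply]
        congr! 3
        ring
    _ ≤ ∑ p : ι × ι, r p.1 * r p.2 * d p := by
        refine (Finset.abs_sum_le_sum_abs _ _).trans (Finset.sum_le_sum fun p _ => ?_)
        rw [abs_mul, abs_mul]
        exact mul_le_mul_of_nonneg_right (mul_le_mul (hw _) (hw _) (abs_nonneg _)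
          ((abs_nonneg _).trans (hw _))) (abs_nonneg _)
    _ = _ := by
        rw [sum_prod_eq_sum_upper (by simp [d, min_comm, max_comm, mul_comm])]
        refine Finset.sum_congr rfl fun e _ => ?_
        simp [d, min_eq_left e.2, max_eq_right e.2, mul_assoc]

theorem sum_upper_mul_sq_le (r : ι → ℝ) :
    ∑ e : {e : ι × ι // e.1 ≤ e.2}, ((if e.1.1 = e.1.2 then 1 else 2) * (r e.1.1 * r e.1.2)) ^ 2 ≤
      2 * (∑ i, r i ^ 2) ^ 2 := by
  have hsq : (∑ i, r i ^ 2) ^ 2 = ∑ p : ι × ι, (r p.1 * r p.2) ^ 2 := by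
    simp only [sq (∑ i, r i ^ 2), Finset.sum_mul_sum, mul_pow, Fintype.sum_prod_type]
  rw [hsq, sum_prod_eq_sum_upper (by simp [mul_comm]), Finset.mul_sum]
  refine Finset.sum_le_sum fun e _ => ?_
  split_ifs
  · linarith [sq_nonneg (r e.1.1 * r e.1.2)]
  · exact le_of_eq (by ring)

theorem WeightedLipschitz.of_quadraticForm {F : ({e : ι × ι // e.1 ≤ e.2} → ℝ) → ℝ} {s : NNReal}
    (h : ∀ x, ∃ r : ι → ℝ, ∑ i, r i ^ 2 ≤ s ∧ ∀ y, ∃ w : ι → ℝ, (∀ i, |w i| ≤ r i) ∧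
      F x - F y ≤ |w ⬝ᵥ (upperMatrix x).mulVec w - w ⬝ᵥ (upperMatrix y).mulVec w|) :
    WeightedLipschitz (2 * s ^ 2) F := by
  intro x
  obtain ⟨r, hr, hF⟩ := h x
  refine ⟨_, (sum_upper_mul_sq_le r).trans ?_, fun y => ?_⟩
  · push_cast
    gcongr
  · obtain ⟨w, hw, hwF⟩ := hF y
    exact hwF.trans (abs_dotProduct_upperMatrix_sub_le hw x y)

end QuadraticForm

section Orthogonality

open scoped InnerProductSpace

theorem exists_norm_eq_one_forall_inner_eq_zero {E : Type*} [NormedAddCommGroup E]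
    [InnerProductSpace ℝ E] {s : Finset E} (hs : s.card < Module.finrank ℝ E) :
    ∃ w : E, ‖w‖ = 1 ∧ ∀ v ∈ s, ⟪v, w⟫_ℝ = 0 := by
  have hspan : (Submodule.span ℝ (s : Set E))ᗮ ≠ ⊥ := by
    intro h
    have htop := Submodule.orthogonal_eq_bot_iff.1 h
    exact hs.not_ge (finrank_top ℝ E ▸ htop ▸ finrank_span_finset_le_card s)
  obtain ⟨w, hw, hw0⟩ := Submodule.exists_mem_ne_zero_of_ne_bot hspan
  refine ⟨‖w‖⁻¹ • w, norm_smul_inv_norm (𝕜 := ℝ) hw0, fun v hv => ?_⟩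
  rw [inner_smul_right, (Submodule.mem_orthogonal _ w).1 hw v (Submodule.subset_span hv), mul_zero]

variable {κ : Type*} [Fintype κ]

theorem exists_norm_eq_one_inner_eq_zero_of_card_lt {E : Type*} [NormedAddCommGroup E]
    [InnerProductSpace ℝ E] (b : OrthonormalBasis κ ℝ E) (v : κ → E) {S T : Finset κ}
    (hST : T.card < S.card) :
    ∃ w : E, ‖w‖ = 1 ∧ (∀ k ∉ S, ⟪b k, w⟫_ℝ = 0) ∧ ∀ k ∈ T, ⟪v k, w⟫_ℝ = 0 := by
  classical
  have hcard : (Sᶜ.image b ∪ T.image v).card < Module.finrank ℝ E := by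
    rw [Module.finrank_eq_card_basis b.toBasis, ← Finset.card_compl_add_card S]
    grw [Finset.card_union_le, Finset.card_image_le, Finset.card_image_le]
    exact Nat.add_lt_add_left hST _
  obtain ⟨w, hw, horth⟩ := exists_norm_eq_one_forall_inner_eq_zero hcard
  simp only [Finset.forall_mem_union, Finset.forall_mem_image, Finset.mem_compl] at horth
  exact ⟨w, hw, horth⟩

variable {ι : Type*} [Fintype ι]

theorem abs_apply_le_sqrt_sum_of_inner_eq_zero (b : OrthonormalBasis κ ℝ (EuclideanSpace ℝ ι))
    {S : Finset κ} {w : EuclideanSpace ℝ ι} (hw : ‖w‖ = 1) (hS : ∀ k ∉ S, ⟪b k, w⟫_ℝ = 0) (i : ι) :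
    |w i| ≤ √(∑ k ∈ S, b k i ^ 2) := by
  have hexpand : w i = ∑ k ∈ S, ⟪b k, w⟫_ℝ * b k i := by
    conv_lhs => rw [← b.sum_repr' w]
    rw [← Finset.sum_subset (Finset.subset_univ S) fun k _ hk => by rw [hS k hk, zero_smul]]
    simp
  refine Real.abs_le_sqrt ?_
  calc w i ^ 2 ≤ (∑ k ∈ S, ⟪b k, w⟫_ℝ ^ 2) * ∑ k ∈ S, b k i ^ 2 :=
        hexpand ▸ Finset.sum_mul_sq_le_sq_mul_sq S _ _
    _ ≤ (∑ k, ⟪b k, w⟫_ℝ ^ 2) * ∑ k ∈ S, b k i ^ 2 := by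
        gcongr
        exact Finset.subset_univ S
    _ = ∑ k ∈ S, b k i ^ 2 := by
        rw [b.sum_sq_inner_right, hw, one_pow, one_mul]

theorem sum_sqrt_sum_sq (b : OrthonormalBasis κ ℝ (EuclideanSpace ℝ ι)) (S : Finset κ) :
    ∑ i, √(∑ k ∈ S, b k i ^ 2) ^ 2 = S.card := by
  have hnorm (k : κ) : ∑ i, b k i ^ 2 = 1 := by
    rw [← one_pow 2, ← b.norm_eq_one k, EuclideanSpace.real_norm_sq_eq]
  have hsqrt (i : ι) : √(∑ k ∈ S, b k i ^ 2) ^ 2 = ∑ k ∈ S, b k i ^ 2 :=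
    Real.sq_sqrt (Finset.sum_nonneg fun _ _ => sq_nonneg _)
  simp only [hsqrt]
  rw [Finset.sum_comm]
  simp [hnorm]

end Orthogonality

section Eigenvalues

open scoped InnerProductSpace

variable {n : ℕ} {A : Matrix (Fin n) (Fin n) ℝ}

theorem delta_antitone (hA : A.IsHermitian) : Antitone (delta hA) := fun i j hij =>
  hA.eigenvalues₀_antitone (show Fin.cast _ i ≤ Fin.cast _ j from hij)

theorem exists_orthonormalBasis_mulVec_eq_delta (hA : A.IsHermitian) :
    ∃ b : OrthonormalBasis (Fin n) ℝ (EuclideanSpace ℝ (Fin n)),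
      ∀ k, A.mulVec (b k).ofLp = delta hA k • (b k).ofLp := by
  let σ : Fin n ≃ Fin n := (finCongr (Fintype.card_fin n).symm).trans
    (Fintype.equivOfCardEq (Fintype.card_fin _))
  refine ⟨hA.eigenvectorBasis.reindex σ.symm, fun k => ?_⟩
  rw [OrthonormalBasis.reindex_apply, Equiv.symm_symm, hA.mulVec_eigenvectorBasis]
  congr 1
  simp [Matrix.IsHermitian.eigenvalues, delta, σ]

theorem dotProduct_mulVec_eq_sum_delta (hA : A.IsHermitian)
    {b : OrthonormalBasis (Fin n) ℝ (EuclideanSpace ℝ (Fin n))}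
    (hb : ∀ k, A.mulVec (b k).ofLp = delta hA k • (b k).ofLp) (x : EuclideanSpace ℝ (Fin n)) :
    x.ofLp ⬝ᵥ A.mulVec x.ofLp = ∑ k, delta hA k * ⟪b k, x⟫_ℝ ^ 2 := by
  have hcoord (k : Fin n) : ⟪b k, WithLp.toLp 2 (A.mulVec x.ofLp)⟫_ℝ = delta hA k * ⟪b k, x⟫_ℝ := by
    have hT : A.IsSymm := by simpa using hA
    simp only [EuclideanSpace.inner_eq_star_dotProduct, star_trivial]
    rw [dotProduct_comm, Matrix.dotProduct_mulVec, ← Matrix.mulVec_transpose, hT.eq, hb k,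
      smul_dotProduct, smul_eq_mul, dotProduct_comm]
  calc x.ofLp ⬝ᵥ A.mulVec x.ofLp = ⟪x, WithLp.toLp 2 (A.mulVec x.ofLp)⟫_ℝ := by
        simp [EuclideanSpace.inner_eq_star_dotProduct, dotProduct_comm]
    _ = ∑ k, ⟪x, b k⟫_ℝ * ⟪b k, WithLp.toLp 2 (A.mulVec x.ofLp)⟫_ℝ :=
        (b.sum_inner_mul_inner _ _).symm
    _ = _ := by
        refine Finset.sum_congr rfl fun k _ => ?_
        rw [hcoord, real_inner_comm]
        ring

variable {b : OrthonormalBasis (Fin n) ℝ (EuclideanSpace ℝ (Fin n))}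
  {x : EuclideanSpace ℝ (Fin n)} {j : Fin n}

theorem dotProduct_mulVec_le_delta (hA : A.IsHermitian)
    (hb : ∀ k, A.mulVec (b k).ofLp = delta hA k • (b k).ofLp) (hx : ‖x‖ = 1)
    (horth : ∀ k < j, ⟪b k, x⟫_ℝ = 0) : x.ofLp ⬝ᵥ A.mulVec x.ofLp ≤ delta hA j := by
  rw [dotProduct_mulVec_eq_sum_delta hA hb]
  calc ∑ k, delta hA k * ⟪b k, x⟫_ℝ ^ 2 ≤ ∑ k, delta hA j * ⟪b k, x⟫_ℝ ^ 2 := by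
        refine Finset.sum_le_sum fun k _ => ?_
        rcases lt_or_ge k j with hk | hk
        · simp [horth k hk]
        · exact mul_le_mul_of_nonneg_right (delta_antitone hA hk) (sq_nonneg _)
    _ = delta hA j := by
        rw [← Finset.mul_sum, b.sum_sq_inner_right, hx, one_pow, mul_one]

theorem delta_le_dotProduct_mulVec (hA : A.IsHermitian)
    (hb : ∀ k, A.mulVec (b k).ofLp = delta hA k • (b k).ofLp) (hx : ‖x‖ = 1)
    (horth : ∀ k > j, ⟪b k, x⟫_ℝ = 0) : delta hA j ≤ x.ofLp ⬝ᵥ A.mulVec x.ofLp := by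
  rw [dotProduct_mulVec_eq_sum_delta hA hb]
  calc delta hA j = ∑ k, delta hA j * ⟪b k, x⟫_ℝ ^ 2 := by
        rw [← Finset.mul_sum, b.sum_sq_inner_right, hx, one_pow, mul_one]
    _ ≤ ∑ k, delta hA k * ⟪b k, x⟫_ℝ ^ 2 := by
        refine Finset.sum_le_sum fun k _ => ?_
        rcases le_or_gt k j with hk | hk
        · exact mul_le_mul_of_nonneg_right (delta_antitone hA hk) (sq_nonneg _)
        · simp [horth k hk]

theorem weightedLipschitz_delta (j : Fin n) :
    WeightedLipschitz (2 * ((j + 1 : ℕ) : NNReal) ^ 2)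
      fun x : {e : Fin n × Fin n // e.1 ≤ e.2} → ℝ => delta (upperMatrix_isHermitian x) j := by
  refine .of_quadraticForm fun x => ?_
  obtain ⟨b, hb⟩ := exists_orthonormalBasis_mulVec_eq_delta (upperMatrix_isHermitian x)
  refine ⟨_, (sum_sqrt_sum_sq b (Finset.Iic j)).trans_le (by simp), fun y => ?_⟩
  obtain ⟨v, hv⟩ := exists_orthonormalBasis_mulVec_eq_delta (upperMatrix_isHermitian y)
  obtain ⟨w, hw, hbw, hvw⟩ := exists_norm_eq_one_inner_eq_zero_of_card_lt b v
    (S := Finset.Iic j) (T := Finset.Iio j) (by simp)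
  refine ⟨w, abs_apply_le_sqrt_sum_of_inner_eq_zero b hw hbw, le_trans ?_ (le_abs_self _)⟩
  exact sub_le_sub
    (delta_le_dotProduct_mulVec _ hb hw fun k hk => hbw k (by simpa using hk))
    (dotProduct_mulVec_le_delta _ hv hw fun k hk => hvw k (by simpa using hk))

theorem weightedLipschitz_neg_delta (j : Fin n) :
    WeightedLipschitz (2 * ((n - j : ℕ) : NNReal) ^ 2)
      fun x : {e : Fin n × Fin n // e.1 ≤ e.2} → ℝ => -delta (upperMatrix_isHermitian x) j := by
  refine .of_quadraticForm fun x => ?_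
  obtain ⟨b, hb⟩ := exists_orthonormalBasis_mulVec_eq_delta (upperMatrix_isHermitian x)
  refine ⟨_, (sum_sqrt_sum_sq b (Finset.Ici j)).trans_le (by simp), fun y => ?_⟩
  obtain ⟨v, hv⟩ := exists_orthonormalBasis_mulVec_eq_delta (upperMatrix_isHermitian y)
  obtain ⟨w, hw, hbw, hvw⟩ := exists_norm_eq_one_inner_eq_zero_of_card_lt b v
    (S := Finset.Ici j) (T := Finset.Ioi j) (by simp; omega)
  refine ⟨w, abs_apply_le_sqrt_sum_of_inner_eq_zero b hw hbw, le_trans ?_ (neg_le_abs _)⟩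
  have hx := dotProduct_mulVec_le_delta _ hb hw fun k hk => hbw k (by simpa using hk)
  have hy := delta_le_dotProduct_mulVec _ hv hw fun k hk => hvw k (by simpa using hk)
  linarith

variable (hn : 2 ≤ n)

theorem lambda2_eq_max (hA : A.IsHermitian) :
    lambda2 hn hA = max (delta2 hn hA) (-deltaLast hn hA) := by
  have h : deltaLast hn hA ≤ delta2 hn hA := delta_antitone hA (Fin.mk_le_mk.2 (by omega))
  refine le_antisymm (max_le (abs_le'.2 ⟨le_max_left _ _, ?_⟩) (abs_le'.2 ⟨?_, le_max_right _ _⟩))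
    (max_le_max (le_abs_self _) (neg_le_abs _))
  · exact (neg_le_neg h).trans (le_max_right _ _)
  · exact h.trans (le_max_left _ _)

theorem weightedLipschitz_delta2 :
    WeightedLipschitz 8 fun x : {e : Fin n × Fin n // e.1 ≤ e.2} → ℝ =>
      delta2 hn (upperMatrix_isHermitian x) :=
  (weightedLipschitz_delta _).mono (by norm_num)

theorem weightedLipschitz_lambda2 :
    WeightedLipschitz 8 fun x : {e : Fin n × Fin n // e.1 ≤ e.2} → ℝ =>
      lambda2 hn (upperMatrix_isHermitian x) := by
  have hlast : n - (n - 1) = 1 := by omega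
  simp only [lambda2_eq_max]
  exact (weightedLipschitz_delta2 hn).sup <| (weightedLipschitz_neg_delta _).mono <| by
    norm_num [hlast]

end Eigenvalues

theorem theorem2_general {n : ℕ} (hn : 2 ≤ n) {Ω : Type*} [MeasurableSpace Ω] {μ : Measure Ω}
    [IsProbabilityMeasure μ] {a : Fin n → Fin n → Ω → ℝ}
    (hm : ∀ i j, i ≤ j → AEMeasurable (a i j) μ)
    (hind : iIndepFun (fun e : {e : Fin n × Fin n // e.1 ≤ e.2} => a e.1.1 e.1.2) μ)
    (hb : ∀ i j, i ≤ j → ∀ᵐ ω ∂μ, |a i j ω| ≤ 1) :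
    (Integrable (randLambda2 hn a) μ ∧
      ∀ t : ℝ, 16 < t →
        μ.real {ω | t ≤ |randLambda2 hn a ω - ∫ ω', randLambda2 hn a ω' ∂μ|}
          ≤ Real.exp (-(1 / 256) * t ^ 2)) ∧
    (Integrable (randDelta2 hn a) μ ∧
      ∀ t : ℝ, 16 < t →
        μ.real {ω | t ≤ |randDelta2 hn a ω - ∫ ω', randDelta2 hn a ω' ∂μ|}
          ≤ Real.exp (-(1 / 256) * t ^ 2)) := by
  have htail {F : ({e : Fin n × Fin n // e.1 ≤ e.2} → ℝ) → ℝ} (hF : WeightedLipschitz 8 F) :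
      Integrable (fun ω => F fun e => a e.1.1 e.1.2 ω) μ ∧ ∀ t : ℝ, 16 < t →
        μ.real {ω | t ≤ |F (fun e => a e.1.1 e.1.2 ω) - ∫ ω', F (fun e => a e.1.1 e.1.2 ω') ∂μ|}
          ≤ Real.exp (-(1 / 256) * t ^ 2) := by
    have hX (e : {e : Fin n × Fin n // e.1 ≤ e.2}) := hm _ _ e.2
    have hIcc (e : {e : Fin n × Fin n // e.1 ≤ e.2}) : ∀ᵐ ω ∂μ, a e.1.1 e.1.2 ω ∈ Set.Icc (-1) 1 :=
      (hb _ _ e.2).mono fun _ => abs_le.1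
    refine ⟨hF.integrable_of_mem_Icc (by norm_num) hX hind hIcc, fun t ht => ?_⟩
    refine (hF.measureReal_abs_sub_integral_ge_le (by norm_num) hX hind hIcc (by linarith)
      (by norm_num; nlinarith)).trans_eq ?_
    norm_num
    ring
  exact ⟨htail (weightedLipschitz_lambda2 hn), htail (weightedLipschitz_delta2 hn)⟩

theorem theorem2 (p : ℝ) (hp : 0 < p) :
    ∃ c K : ℝ, 0 < c ∧ 0 < K ∧
      ∀ (n : ℕ) (hn : 2 ≤ n) (Ω : Type*) [MeasurableSpace Ω] (μ : Measure Ω)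
        [IsProbabilityMeasure μ] (a : Fin n → Fin n → Ω → ℝ),
        (∀ i j, i ≤ j → Measurable (a i j)) →
        iIndepFun (fun e : {e : Fin n × Fin n // e.1 ≤ e.2} => a e.1.1 e.1.2) μ →
        (∀ i j, i ≤ j → ∀ᵐ ω ∂μ, |a i j ω| ≤ 1) →
        (∀ i j, i < j → ∫ ω, a i j ω ∂μ = p) →
        (Integrable (randLambda2 hn a) μ ∧
          ∀ t : ℝ, K < t →
            μ.real {ω | t ≤ |randLambda2 hn a ω - ∫ ω', randLambda2 hn a ω' ∂μ|}
              ≤ Real.exp (-c * t ^ 2)) ∧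
        (Integrable (randDelta2 hn a) μ ∧
          ∀ t : ℝ, K < t →
            μ.real {ω | t ≤ |randDelta2 hn a ω - ∫ ω', randDelta2 hn a ω' ∂μ|}
              ≤ Real.exp (-c * t ^ 2)) :=
  ⟨1 / 256, 16, by norm_num, by norm_num, fun _ hn _ _ _ _ _ hm hind hb _ =>
    theorem2_general hn (fun i j hij => (hm i j hij).aemeasurable) hind hb⟩
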